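/- Let $G$ be a finite simple graph with adjacency eigenvalues $\lambda_1\ge\cdots\ge\lambda_n$, listed with multiplicity, where $n=|V(G)|\ge 1$, and define its HL-index by $$R(G)=\max\left\{|\lambda_{\lfloor (n+1)/2\rfloor}|,\ |\lambda_{\lceil (n+1)/2\rceil}|\right\}.$$ Let $k\ge 3$ be an integer and suppose that $G$ is connected, bipartite and $k$-regular. If $R(G)>\sqrt{k-2}$, then $R(G)=\sqrt{k-1}$ and $G$ is (isomorphic to) the incidence graph of a finite projective plane of order $k-1$, that is, the bipartite graph whose vertices are the points and the lines of the plane, a point being adjacent to exactly the lines through it. -/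

import Mathlib

universe u

namespace HLPaper

/-- The eigenvalues `lam G 0 ≥ lam G 1 ≥ ... ≥ lam G (n - 1)` of the adjacency matrix of a
finite simple graph `G` of order `n`, listed with multiplicity in non-increasing order.
The classical `i`-th eigenvalue (counted from `1`) is the one with index `i - 1` here. -/
noncomputable def lam {V : Type u} [Fintype V] [DecidableEq V]
    (G : SimpleGraph V) [DecidableRel G.Adj] : Fin (Fintype.card V) → ℝ :=
  (G.isHermitian_adjMatrix ℝ).eigenvalues₀

theorem floor_index_lt {n : ℕ} (hn : 0 < n) : (n + 1) / 2 - 1 < n := by omega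

theorem ceil_index_lt {n : ℕ} (hn : 0 < n) : (n + 2) / 2 - 1 < n := by omega

/-- The HL-index of a graph of order `n > 0`: the larger of the absolute values of the median
eigenvalues, which are those at the positions `⌊(n + 1) / 2⌋` and `⌈(n + 1) / 2⌉`, counted from
`1`, in non-increasing order. In natural-number division the latter is `(n + 2) / 2`. -/
noncomputable def HLIndex {V : Type u} [Fintype V] [DecidableEq V] [Nonempty V]
    (G : SimpleGraph V) [DecidableRel G.Adj] : ℝ :=
  max |lam G ⟨(Fintype.card V + 1) / 2 - 1, floor_index_lt Fintype.card_pos⟩|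
    |lam G ⟨(Fintype.card V + 2) / 2 - 1, ceil_index_lt Fintype.card_pos⟩|

/-- The incidence graph (Levi graph) of a configuration of points `P` and lines `L`: its vertices
are the points and the lines, and its edges join each point to the lines through it. -/
def incidenceGraph (P L : Type u) [Membership P L] : SimpleGraph (P ⊕ L) where
  Adj
    | .inl p, .inr l => p ∈ l
    | .inr l, .inl p => p ∈ l
    | _, _ => False
  symm := ⟨by rintro (p | l) (q | m) h <;> exact h⟩
  loopless := ⟨by rintro (p | l) h <;> exact h⟩

/-- `G` is (isomorphic to) the incidence graph of a finite projective plane of order `q`. -/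
def IsIncidenceGraphOfProjectivePlane {V : Type u} (G : SimpleGraph V) (q : ℕ) : Prop :=
  ∃ (P L : Type u) (_ : Finite P) (_ : Finite L) (_ : Membership P L)
    (_ : Configuration.ProjectivePlane P L),
    Configuration.ProjectivePlane.order P L = q ∧ Nonempty (G ≃g incidenceGraph P L)

end HLPaper

/-! The spectrum of a bipartite graph is symmetric about 0, so R(G) is the least absolute value of
an eigenvalue. Hence R(G) > √(k-2) makes M = A² - (k-2)I positive definite (`shiftedSq`). It is
integral with diagonal 2, and its off-diagonal entries count common neighbours. Positive 2×2 minors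
bound these entries by 1, so two vertices have at most one common neighbour; call distinct vertices
with one collinear.

On a colour class M is the Gram matrix of a connected system of norm-2 vectors, with constant row
sum k²-k+2 ≥ 8, which divides the determinant (`rowSum_dvd_det`). If the collinearity graph had an
induced claw or diamond, the lattice would contain D₄, whose determinant is 4 and whose dual has
minimum norm 1. Adjoining the other vectors one at a time keeps the dual minimum at least 1 and
never increases the determinant (`DualNormGeOne.border`), so the determinant would be at most 4, a
contradiction.

Without claws and diamonds, counting on lines makes collinearity transitive (`collinear_trans`).
Each colour class is therefore pairwise collinear, which gives the axioms of a plane; and A² =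
(k-1)I + J, with J the same-colour indicator, leaves only k² and k-1 as squared eigenvalues. -/

open Matrix in
/-- Every nonzero vector of the dual of the lattice with Gram matrix `A` has norm at least one. -/
def DualNormGeOne {ι : Type*} [Fintype ι] (A : Matrix ι ι ℝ) : Prop :=
  ∀ z : ι → ℝ, (∀ i, ∃ a : ℤ, (A *ᵥ z) i = a) → z ≠ 0 → 1 ≤ z ⬝ᵥ A *ᵥ z

/-! ### Dual lattices and determinant bounds -/

section Lattice

open Matrix

theorem DualNormGeOne.reindex {ι κ : Type*} [Fintype ι] [Fintype κ] {A : Matrix ι ι ℝ}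
    (hA : DualNormGeOne A) (e : κ ≃ ι) : DualNormGeOne (A.submatrix e e) := by
  intro z hz h0
  have h1 : (A.submatrix e e) *ᵥ z = (A *ᵥ (z ∘ e.symm)) ∘ e := by
    rw [Matrix.submatrix_mulVec_equiv]
  rw [h1] at hz ⊢
  have h2 := hA (z ∘ e.symm) (fun i => by simpa using hz (e.symm i)) (fun h => h0 (by
    ext i; simpa using congrFun h (e i)))
  rwa [comp_equiv_symm_dotProduct] at h2

theorem one_le_sq_of_ne_zero {a : ℤ} (ha : a ≠ 0) : 1 ≤ a ^ 2 :=
  Int.add_one_le_iff.2 (sq_pos_of_ne_zero ha)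

/-- Here `y` gives the projection of the new norm-2 vector to the old span. It is a nonzero dual
vector, so its norm is at least 1 and the determinant is multiplied by τ = 2 - |y|² ≤ 1. A new dual
vector splits orthogonally, with norm |u|² + s²τ and `u` in the old dual. -/
theorem DualNormGeOne.border {ι : Type*} [Fintype ι] [DecidableEq ι] {A : Matrix ι ι ℝ}
    (hA : DualNormGeOne A) {b : ι → ℝ} (hbz : ∀ i, ∃ a : ℤ, b i = a) (hb : b ≠ 0)
    (hpos : (fromBlocks A (replicateCol (Fin 1) b) (replicateRow (Fin 1) b)
      (of fun _ _ => (2 : ℝ))).PosDef) :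
    DualNormGeOne (fromBlocks A (replicateCol (Fin 1) b) (replicateRow (Fin 1) b)
      (of fun _ _ => (2 : ℝ))) ∧
    (fromBlocks A (replicateCol (Fin 1) b) (replicateRow (Fin 1) b)
      (of fun _ _ => (2 : ℝ))).det ≤ A.det := by
  have hAp : A.PosDef := by
    exact hpos.submatrix (e := Sum.inl) Sum.inl_injective
  have hsymm : Aᵀ = A := by simpa using hAp.isHermitian.eq
  have hdet : 0 < A.det := hAp.det_pos
  set y : ι → ℝ := A⁻¹ *ᵥ b with hy
  have hAy : A *ᵥ y = b := by
    rw [hy, mulVec_mulVec, Matrix.mul_nonsing_inv _ (isUnit_iff_ne_zero.2 hdet.ne'), one_mulVec]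
  have hcomm : ∀ u : ι → ℝ, y ⬝ᵥ A *ᵥ u = b ⬝ᵥ u := fun u => by
    rw [dotProduct_mulVec, ← mulVec_transpose, hsymm, hAy]
  set τ : ℝ := 2 - b ⬝ᵥ y with hτ
  have hdet' : (fromBlocks A (replicateCol (Fin 1) b) (replicateRow (Fin 1) b)
      (of fun _ _ => (2 : ℝ))).det = A.det * τ := by
    have := A.invertibleOfIsUnitDet (isUnit_iff_ne_zero.2 hdet.ne')
    rw [det_fromBlocks₁₁]
    congr 1
    rw [det_fin_one, hτ, hy, invOf_eq_nonsing_inv, Matrix.mul_assoc]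
    simp [Matrix.mul_apply, dotProduct, mulVec]
  have hτ0 : 0 < τ := by
    have := hpos.det_pos
    rw [hdet'] at this
    exact (mul_pos_iff_of_pos_left hdet).1 this
  have hτ1 : τ ≤ 1 := by
    have h := hA y (by rw [hAy]; exact hbz) (fun h => hb (by rw [← hAy, h, mulVec_zero]))
    rw [hAy, dotProduct_comm] at h
    linarith
  refine ⟨fun z' hz hz0 => ?_, ?_⟩
  · obtain ⟨z, s, rfl⟩ : ∃ (z : ι → ℝ) (s : ℝ), z' = Sum.elim z fun _ => s :=
      ⟨z' ∘ Sum.inl, z' (Sum.inr 0), by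
        ext (i | i)
        · simp
        · simp [Subsingleton.elim i 0]⟩
    have hmul : (fromBlocks A (replicateCol (Fin 1) b) (replicateRow (Fin 1) b)
        (of fun _ _ => (2 : ℝ))) *ᵥ (Sum.elim z fun _ => s) =
        Sum.elim (A *ᵥ z + s • b) (fun _ => b ⬝ᵥ z + 2 * s) := by
      rw [fromBlocks_mulVec]
      congr 1
      · ext i; simp [mulVec, dotProduct, mul_comm]
      · ext i; simp [mulVec, dotProduct]
    rw [hmul] at hz ⊢
    set u : ι → ℝ := z + s • y with hu
    have hAu : A *ᵥ u = A *ᵥ z + s • b := by rw [hu, mulVec_add, mulVec_smul, hAy]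
    have hz1 : z = u - s • y := by simp [hu]
    have hh : b ⬝ᵥ z + 2 * s = b ⬝ᵥ u + s * τ := by
      rw [hz1, hτ, dotProduct_sub, dotProduct_smul, smul_eq_mul]; ring
    have hval : (Sum.elim z fun _ => s) ⬝ᵥ
        (Sum.elim (A *ᵥ z + s • b) (fun _ : Fin 1 => b ⬝ᵥ z + 2 * s)) =
        u ⬝ᵥ A *ᵥ u + s ^ 2 * τ := by
      rw [sumElim_dotProduct_sumElim, ← hAu, hh]
      conv_lhs => rw [hz1]
      rw [sub_dotProduct, smul_dotProduct, hcomm]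
      simp [dotProduct]
      ring
    rw [hval]
    -- If `u = 0`, integrality of the last pairing makes sτ a nonzero integer, so s²τ = (sτ)²/τ ≥ 1.
    -- Otherwise the old bound applies to `u`.
    by_cases hu0 : u = 0
    · obtain ⟨a, ha⟩ := hz (Sum.inr 0)
      simp only [Sum.elim_inr] at ha
      rw [hh, hu0, dotProduct_zero, zero_add] at ha
      have hs : s ≠ 0 := by
        rintro rfl
        apply hz0
        ext (i | i)
        · rw [hz1, hu0]; simp
        · simp
      have ha0 : a ≠ 0 := by
        rintro rfl
        simp [hs, hτ0.ne'] at ha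
      have ha1 : (1 : ℝ) ≤ (a : ℝ) ^ 2 := by
        have : (1 : ℤ) ≤ a ^ 2 := one_le_sq_of_ne_zero ha0 
        exact_mod_cast this
      rw [hu0, zero_dotProduct, zero_add]
      rw [← ha] at ha1
      nlinarith [sq_nonneg s]
    · have := hA u (fun i => by rw [hAu]; simpa using hz (Sum.inl i)) hu0
      have := mul_nonneg (sq_nonneg s) hτ0.le
      linarith
  · rw [hdet']
    nlinarith

/-- Connectivity always supplies a new index with a nonzero entry against the current set, which is
the condition `b ≠ 0` needed for bordering. -/
theorem exists_embedding_det_le {V : Type*} [Fintype V] [DecidableEq V] {M : Matrix V V ℤ}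
    (hdiag : ∀ v, M v v = 2) (hpos : (M.map (Int.cast : ℤ → ℝ)).PosDef)
    (hconn : ∀ X : Finset V, X.Nonempty → X ≠ Finset.univ → ∃ x ∉ X, ∃ y ∈ X, M x y ≠ 0)
    {n₀ : ℕ} (h₀ : 0 < n₀) {f₀ : Fin n₀ → V} (hinj : Function.Injective f₀)
    (hdual : DualNormGeOne ((M.map (Int.cast : ℤ → ℝ)).submatrix f₀ f₀))
    {D : ℝ} (hD : ((M.map (Int.cast : ℤ → ℝ)).submatrix f₀ f₀).det ≤ D) {n : ℕ} (hn : n₀ ≤ n)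
    (hnV : n ≤ Fintype.card V) :
    ∃ f : Fin n → V, Function.Injective f ∧
      DualNormGeOne ((M.map (Int.cast : ℤ → ℝ)).submatrix f f) ∧
      ((M.map (Int.cast : ℤ → ℝ)).submatrix f f).det ≤ D := by
  induction n, hn using Nat.le_induction with
  | base => exact ⟨f₀, hinj, hdual, hD⟩
  | succ n hn ih =>
    obtain ⟨f, hf, hfd, hfD⟩ := ih (by omega)
    have hcard : (Finset.univ.image f).card = n := by
      rw [Finset.card_image_of_injective _ hf]; simp
    obtain ⟨x, hx, y, hy, hxy⟩ := hconn (Finset.univ.image f)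
      (Finset.card_pos.1 (by omega)) (fun h => by
        rw [h, Finset.card_univ] at hcard; omega)
    have hsymm : ∀ u v, M u v = M v u := fun u v => by
      have := congrFun (congrFun hpos.isHermitian.eq v) u
      simpa using this
    let g : Fin n ⊕ Fin 1 → V := Sum.elim f fun _ => x
    have hg : Function.Injective g := by
      refine Function.Injective.sumElim hf (fun _ _ _ => Subsingleton.elim _ _) ?_
      rintro i - rfl
      exact hx (Finset.mem_image_of_mem _ (Finset.mem_univ _))
    have hblock : (M.map (Int.cast : ℤ → ℝ)).submatrix g g =
        fromBlocks ((M.map (Int.cast : ℤ → ℝ)).submatrix f f)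
          (replicateCol (Fin 1) fun i => (M x (f i) : ℝ))
          (replicateRow (Fin 1) fun i => (M x (f i) : ℝ)) (of fun _ _ => (2 : ℝ)) := by
      ext (i | i) (j | j) <;> simp [g, hdiag, hsymm _ x]
    have hgp := hpos.submatrix hg
    rw [hblock] at hgp
    obtain ⟨h1, h2⟩ := hfd.border (fun i => ⟨_, rfl⟩) (fun h => hxy (by
      obtain ⟨i, -, rfl⟩ := Finset.mem_image.1 hy
      simpa using congrFun h i)) hgp
    rw [← hblock] at h1 h2
    refine ⟨g ∘ finSumFinEquiv.symm, hg.comp finSumFinEquiv.symm.injective, ?_, ?_⟩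
    · rw [← Matrix.submatrix_submatrix]
      exact h1.reindex _
    · rw [← Matrix.submatrix_submatrix, det_submatrix_equiv_self]
      exact h2.trans hfD

/-- The determinant of a connected integral positive definite matrix with diagonal `2` is at most
that of a principal submatrix whose dual lattice has minimum at least one. -/
theorem det_le_of_submatrix {V : Type*} [Fintype V] [DecidableEq V] {M : Matrix V V ℤ}
    (hdiag : ∀ v, M v v = 2) (hpos : (M.map (Int.cast : ℤ → ℝ)).PosDef)
    (hconn : ∀ X : Finset V, X.Nonempty → X ≠ Finset.univ → ∃ x ∉ X, ∃ y ∈ X, M x y ≠ 0)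
    {n₀ : ℕ} (h₀ : 0 < n₀) {f₀ : Fin n₀ → V} (hinj : Function.Injective f₀)
    (hdual : DualNormGeOne ((M.map (Int.cast : ℤ → ℝ)).submatrix f₀ f₀))
    {D : ℝ} (hD : ((M.map (Int.cast : ℤ → ℝ)).submatrix f₀ f₀).det ≤ D) : (M.det : ℝ) ≤ D := by
  obtain ⟨f, hf, -, h⟩ := exists_embedding_det_le hdiag hpos hconn h₀ hinj hdual hD
    (n := Fintype.card V) (by simpa using Fintype.card_le_of_injective _ hinj) le_rfl
  have hb : Function.Bijective f := (Fintype.bijective_iff_injective_and_card f).2 ⟨hf, by simp⟩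
  have := det_submatrix_equiv_self (Equiv.ofBijective f hb) (M.map (Int.cast : ℤ → ℝ))
  have h3 := (Int.castRingHom ℝ).map_det M
  simp only [eq_intCast] at h3
  rw [h3]
  calc _ = _ := this.symm
    _ ≤ D := h

/-- This is the minimum of the dual of D₄: the coordinates are all integers or all halves of odd
integers, according to the parity of c + d. -/
theorem one_le_sum_sq_of_same_parity {q₁ q₂ q₃ q₄ : ℝ} {a b c d : ℤ} (h₂ : q₁ + q₂ = a)
    (h₃ : q₁ + q₃ = b) (h₄ : q₁ + q₄ = c) (h₅ : q₁ - q₄ = d)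
    (h0 : ¬ (q₁ = 0 ∧ q₂ = 0 ∧ q₃ = 0 ∧ q₄ = 0)) :
    1 ≤ q₁ ^ 2 + q₂ ^ 2 + q₃ ^ 2 + q₄ ^ 2 := by
  have e1 : q₁ = ((c + d : ℤ) : ℝ) / 2 := by push_cast; linarith
  have e2 : q₂ = ((2 * a - (c + d) : ℤ) : ℝ) / 2 := by push_cast; linarith
  have e3 : q₃ = ((2 * b - (c + d) : ℤ) : ℝ) / 2 := by push_cast; linarith
  have e4 : q₄ = ((c - d : ℤ) : ℝ) / 2 := by push_cast; linarith
  have key : 4 ≤ (c + d) ^ 2 + (2 * a - (c + d)) ^ 2 + (2 * b - (c + d)) ^ 2 + (c - d) ^ 2 := by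
    rcases Int.even_or_odd' (c + d) with ⟨t, ht | ht⟩
    · have hd : d = 2 * t - c := by omega
      subst hd
      have h1 : ¬ (t = 0 ∧ a - t = 0 ∧ b - t = 0 ∧ c - t = 0) := by
        rintro ⟨r1, r2, r3, r4⟩
        apply h0
        rw [e1, e2, e3, e4]
        have hc : c = 0 := by omega
        have ha : a = 0 := by omega
        have hb : b = 0 := by omega
        subst r1 hc ha hb
        simp
      have h2 : 1 ≤ t ^ 2 + (a - t) ^ 2 + (b - t) ^ 2 + (c - t) ^ 2 := by
        by_contra! hlt
        apply h1
        have := sq_nonneg t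
        have := sq_nonneg (a - t)
        have := sq_nonneg (b - t)
        have := sq_nonneg (c - t)
        refine ⟨?_, ?_, ?_, ?_⟩ <;> exact pow_eq_zero_iff (two_ne_zero) |>.1 (by omega)
      nlinarith
    · have o1 := one_le_sq_of_ne_zero (show c + d ≠ 0 by omega)
      have o2 := one_le_sq_of_ne_zero (show 2 * a - (c + d) ≠ 0 by omega)
      have o3 := one_le_sq_of_ne_zero (show 2 * b - (c + d) ≠ 0 by omega)
      have o4 := one_le_sq_of_ne_zero (show c - d ≠ 0 by omega)
      linarith
  have key' : (4 : ℝ) ≤ ((c + d : ℤ) : ℝ) ^ 2 + ((2 * a - (c + d) : ℤ) : ℝ) ^ 2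
    + ((2 * b - (c + d) : ℤ) : ℝ) ^ 2 + ((c - d : ℤ) : ℝ) ^ 2 := by exact_mod_cast key
  rw [e1, e2, e3, e4]
  linarith

theorem dualNormGeOne_claw :
    DualNormGeOne !![(2 : ℝ), 1, 1, 1; 1, 2, 0, 0; 1, 0, 2, 0; 1, 0, 0, 2] := by
  intro z hz h0
  obtain ⟨a0, h0'⟩ := hz 0
  obtain ⟨a1, h1⟩ := hz 1
  obtain ⟨a2, h2⟩ := hz 2
  obtain ⟨a3, h3⟩ := hz 3
  simp [mulVec, dotProduct, Fin.sum_univ_four] at h0' h1 h2 h3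
  -- Coordinates in the basis (1,1,0,0), (1,0,0,1), (1,0,0,-1), (0,1,-1,0) of D₄, whose Gram matrix
  -- is the claw.
  have := one_le_sum_sq_of_same_parity (q₁ := z 0 + z 1 + z 2) (q₂ := z 0 + z 3) (q₃ := -z 3)
    (q₄ := z 1 - z 2) (a := a0) (b := a0 - a3) (c := a1) (d := a2)
    (by linarith) (by push_cast; linarith) (by linarith) (by linarith) (fun h => h0 (by
      obtain ⟨r1, r2, r3, r4⟩ := h
      ext i
      fin_cases i <;> simp <;> linarith))
  simp [mulVec, dotProduct, Fin.sum_univ_four]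
  linarith

theorem dualNormGeOne_diamond :
    DualNormGeOne !![(2 : ℝ), 1, 1, 1; 1, 2, 1, 1; 1, 1, 2, 0; 1, 1, 0, 2] := by
  intro z hz h0
  obtain ⟨a0, h0'⟩ := hz 0
  obtain ⟨a1, h1⟩ := hz 1
  obtain ⟨a2, h2⟩ := hz 2
  obtain ⟨a3, h3⟩ := hz 3
  simp [mulVec, dotProduct, Fin.sum_univ_four] at h0' h1 h2 h3
  -- Coordinates in the basis (1,1,0,0), (1,0,1,0), (1,0,0,1), (1,0,0,-1) of D₄.
  have := one_le_sum_sq_of_same_parity (q₁ := z 0 + z 1 + z 2 + z 3) (q₂ := z 0) (q₃ := z 1)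
    (q₄ := z 2 - z 3) (a := a0) (b := a1) (c := a2) (d := a3)
    (by linarith) (by linarith) (by linarith) (by linarith) (fun h => h0 (by
      obtain ⟨r1, r2, r3, r4⟩ := h
      ext i
      fin_cases i <;> simp <;> linarith))
  simp [mulVec, dotProduct, Fin.sum_univ_four]
  linarith

theorem det_claw : (!![(2 : ℝ), 1, 1, 1; 1, 2, 0, 0; 1, 0, 2, 0; 1, 0, 0, 2]).det = 4 := by
  simp [det_succ_row_zero, Fin.sum_univ_succ, Fin.succAbove]
  norm_num

theorem det_diamond : (!![(2 : ℝ), 1, 1, 1; 1, 2, 1, 1; 1, 1, 2, 0; 1, 1, 0, 2]).det = 4 := by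
  simp [det_succ_row_zero, Fin.sum_univ_succ, Fin.succAbove]
  norm_num

/-- Apply adj(M)·M = det(M)·I to the all-ones vector. -/
theorem rowSum_dvd_det {V : Type*} [Fintype V] [DecidableEq V] [Nonempty V] {M : Matrix V V ℤ}
    {s : ℤ} (hs : ∀ v, ∑ w, M v w = s) : s ∣ M.det := by
  obtain ⟨v⟩ := ‹Nonempty V›
  have h1 : M *ᵥ (fun _ => 1) = fun _ => s := by ext w; simp [mulVec, dotProduct, hs]
  have h2 := congrFun (congrArg (M.adjugate *ᵥ ·) h1) v
  simp only [mulVec_mulVec, adjugate_mul, smul_mulVec, one_mulVec] at h2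
  refine ⟨∑ w, M.adjugate v w, ?_⟩
  simp [mulVec, dotProduct, ← Finset.sum_mul] at h2
  rw [h2, mul_comm]

end Lattice

/-! ### Symmetric spectra and the median eigenvalue -/

section Spectrum

open Matrix Polynomial

namespace Matrix.IsHermitian

variable {V : Type*} [Fintype V] [DecidableEq V] {A : Matrix V V ℝ}

theorem charpoly_neg_eq_prod (hA : A.IsHermitian) :
    (-A).charpoly = ∏ i, (X - C (-hA.eigenvalues i)) := by
  have h : -A = Unitary.conjStarAlgAut ℝ _ hA.eigenvectorUnitary
      (diagonal fun i => -hA.eigenvalues i) := by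
    conv_lhs => rw [hA.spectral_theorem]
    rw [← map_neg, diagonal_neg]
    rfl
  rw [h, Unitary.conjStarAlgAut_apply, charpoly_mul_comm, ← mul_assoc]
  simp [charpoly_diagonal]

theorem roots_charpoly_neg (hA : A.IsHermitian) :
    (-A).charpoly.roots = A.charpoly.roots.map Neg.neg := by
  rw [charpoly_neg_eq_prod hA, Polynomial.roots_prod _ _
    (by simp only [Finset.prod_ne_zero_iff]; exact fun i _ => X_sub_C_ne_zero _),
    hA.roots_charpoly_eq_eigenvalues]
  simp [Multiset.map_map]

theorem eigenvalues₀_eq_neg_rev (hA : A.IsHermitian) (hneg : (-A).charpoly = A.charpoly)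
    (i : Fin (Fintype.card V)) : hA.eigenvalues₀ i = -hA.eigenvalues₀ i.rev := by
  have h1 : (List.ofFn hA.eigenvalues₀).Perm (List.ofFn fun i : Fin (Fintype.card V) => -hA.eigenvalues₀ i.rev) := by
    rw [← Multiset.coe_eq_coe, ← Fin.univ_val_map, ← Fin.univ_val_map]
    have h2 := hA.roots_charpoly_neg
    rw [hneg, hA.roots_charpoly_eq_eigenvalues₀, Multiset.map_map] at h2
    have h3 : Multiset.map (fun i : Fin (Fintype.card V) => -hA.eigenvalues₀ i.rev) Finset.univ.val =
        Multiset.map (fun i => -hA.eigenvalues₀ i) Finset.univ.val := by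
      have := congrArg Finset.val (Finset.map_univ_equiv (Fin.revPerm (n := Fintype.card V)))
      conv_rhs => rw [← this]
      rw [Finset.map_val, Multiset.map_map]
      rfl
    rw [h3]
    exact h2
  have h4 := List.Perm.eq_of_sortedGE hA.eigenvalues₀_antitone.sortedGE_ofFn
    (Antitone.sortedGE_ofFn (f := fun i : Fin (Fintype.card V) => -hA.eigenvalues₀ i.rev) (fun a b hab =>
      neg_le_neg (hA.eigenvalues₀_antitone (Fin.rev_le_rev.2 hab)))) h1
  exact congrFun (List.ofFn_injective h4) i

theorem sq_eq_conj (hA : A.IsHermitian) :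
    A * A = Unitary.conjStarAlgAut ℝ _ hA.eigenvectorUnitary
      (diagonal fun i => hA.eigenvalues i ^ 2) := by
  conv_lhs => rw [hA.spectral_theorem]
  rw [← map_mul, diagonal_mul_diagonal]
  simp [sq]

theorem sq_sub_eq_conj (hA : A.IsHermitian) (t : ℝ) :
    A * A - t • (1 : Matrix V V ℝ) = Unitary.conjStarAlgAut ℝ _ hA.eigenvectorUnitary
      (diagonal fun i => hA.eigenvalues i ^ 2 - t) := by
  have h : (diagonal fun i => hA.eigenvalues i ^ 2 - t) =
      (diagonal fun i => hA.eigenvalues i ^ 2) - t • (1 : Matrix V V ℝ) := by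
    rw [smul_one_eq_diagonal, diagonal_sub]
  rw [h, map_sub, ← sq_eq_conj, map_smul, map_one]

theorem posDef_sq_sub (hA : A.IsHermitian) {t : ℝ} (h : ∀ i, t < hA.eigenvalues i ^ 2) :
    (A * A - t • (1 : Matrix V V ℝ)).PosDef := by
  have hu : IsUnit (hA.eigenvectorUnitary : Matrix V V ℝ) :=
    (Unitary.toUnits hA.eigenvectorUnitary).isUnit
  rw [sq_sub_eq_conj hA, Unitary.conjStarAlgAut_apply,
    Matrix.IsUnit.posDef_star_right_conjugate_iff hu, posDef_diagonal_iff]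
  exact fun i => sub_pos.2 (h i)

theorem eigenvalues_sq_eq_or (hA : A.IsHermitian) {s t : ℝ}
    (h : (A * A - s • (1 : Matrix V V ℝ)) * (A * A - t • (1 : Matrix V V ℝ)) = 0) (i : V) :
    hA.eigenvalues i ^ 2 = s ∨ hA.eigenvalues i ^ 2 = t := by
  rw [sq_sub_eq_conj hA, sq_sub_eq_conj hA, ← map_mul, diagonal_mul_diagonal,
    EmbeddingLike.map_eq_zero_iff] at h
  have := congrFun (congrFun h i) i
  simpa [sub_eq_zero] using this

theorem trace_sq (hA : A.IsHermitian) : (A * A).trace = ∑ i, hA.eigenvalues i ^ 2 := by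
  rw [sq_eq_conj hA, Unitary.conjStarAlgAut_apply, trace_mul_comm, ← mul_assoc]
  simp [trace_diagonal]

end Matrix.IsHermitian

namespace SimpleGraph

variable {V : Type*} [Fintype V] [DecidableEq V] {G : SimpleGraph V} [DecidableRel G.Adj]

/-- Conjugation by the diagonal matrix of colour signs negates the adjacency matrix. -/
theorem Coloring.charpoly_neg_adjMatrix (c : G.Coloring (Fin 2)) :
    (-G.adjMatrix ℝ).charpoly = (G.adjMatrix ℝ).charpoly := by
  let d : V → ℝ := fun v => if c v = 0 then 1 else -1
  have hd : ∀ v, d v * d v = 1 := fun v => by by_cases h : c v = 0 <;> simp [d, h]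
  have hdd : diagonal d * diagonal d = 1 := by
    rw [diagonal_mul_diagonal, ← diagonal_one]; congr; ext v; exact hd v
  have h : -G.adjMatrix ℝ = diagonal d * G.adjMatrix ℝ * diagonal d := by
    ext v w
    rw [mul_diagonal, diagonal_mul, neg_apply, adjMatrix_apply]
    split_ifs with hvw
    · have := c.valid hvw
      have : d v * d w = -1 := by
        simp only [d]
        generalize c v = a at *
        generalize c w = b at *
        fin_cases a <;> fin_cases b <;> simp at *
      linarith
    · simp
  rw [h, charpoly_mul_comm, ← mul_assoc, hdd, one_mul]

end SimpleGraph

namespace HLPaper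

variable {V : Type u} [Fintype V] [DecidableEq V] [Nonempty V] {G : SimpleGraph V}
  [DecidableRel G.Adj]

theorem HLIndex_eq (c : G.Coloring (Fin 2)) :
    HLIndex G = lam G ⟨(Fintype.card V + 1) / 2 - 1, floor_index_lt Fintype.card_pos⟩ ∧
      0 ≤ HLIndex G := by
  set i : Fin (Fintype.card V) := ⟨(Fintype.card V + 1) / 2 - 1, floor_index_lt Fintype.card_pos⟩
    with hi
  have hpos : 0 < Fintype.card V := Fintype.card_pos
  have hrev : (⟨(Fintype.card V + 2) / 2 - 1, ceil_index_lt Fintype.card_pos⟩ :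
      Fin (Fintype.card V)) = i.rev := by
    ext; simp only [hi, Fin.val_rev]; omega
  have hs : lam G i = -lam G i.rev :=
    (G.isHermitian_adjMatrix ℝ).eigenvalues₀_eq_neg_rev c.charpoly_neg_adjMatrix i
  have hle : lam G i.rev ≤ lam G i := (G.isHermitian_adjMatrix ℝ).eigenvalues₀_antitone
    (by rw [Fin.le_def]; simp only [hi, Fin.val_rev]; omega)
  have h0 : 0 ≤ lam G i := by linarith
  have h1 : HLIndex G = lam G i := by
    rw [HLIndex, hrev, ← hi, ← abs_neg (lam G i.rev), ← hs, max_self, abs_of_nonneg h0]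
  exact ⟨h1, h1 ▸ h0⟩

/-- Eigenvalues up to the median position are at least the nonnegative median; the later ones are
negatives of these. -/
theorem HLIndex_sq_le (c : G.Coloring (Fin 2)) (v : V) :
    HLIndex G ^ 2 ≤ (G.isHermitian_adjMatrix ℝ).eigenvalues v ^ 2 := by
  obtain ⟨h1, h0⟩ := HLIndex_eq c
  have key : ∀ j, HLIndex G ≤ |lam G j| := by
    intro j
    have hs : lam G j = -lam G j.rev :=
      (G.isHermitian_adjMatrix ℝ).eigenvalues₀_eq_neg_rev c.charpoly_neg_adjMatrix j
    rw [h1]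
    by_cases hj : j.val ≤ (Fintype.card V + 1) / 2 - 1
    · exact ((G.isHermitian_adjMatrix ℝ).eigenvalues₀_antitone (by rwa [Fin.le_def])).trans
        (le_abs_self _)
    · rw [hs, abs_neg]
      refine ((G.isHermitian_adjMatrix ℝ).eigenvalues₀_antitone ?_).trans (le_abs_self _)
      rw [Fin.le_def, Fin.val_rev]
      have := j.isLt
      simp only
      omega
  rw [← sq_abs (Matrix.IsHermitian.eigenvalues _ v)]
  exact pow_le_pow_left₀ h0 (key _) 2

theorem exists_eigenvalue_eq_HLIndex (c : G.Coloring (Fin 2)) :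
    ∃ v, (G.isHermitian_adjMatrix ℝ).eigenvalues v = HLIndex G := by
  rw [(HLIndex_eq c).1]
  exact ⟨Fintype.equivOfCardEq (Fintype.card_fin _)
    ⟨(Fintype.card V + 1) / 2 - 1, floor_index_lt Fintype.card_pos⟩,
    by simp [Matrix.IsHermitian.eigenvalues, lam]⟩

end HLPaper

end Spectrum

/-! ### Collinearity in the two colour classes -/

section Collinearity

open Matrix

namespace SimpleGraph

variable {V : Type*} {G : SimpleGraph V} {k : ℕ}

/-- Two distinct vertices with a common neighbour. -/
def Collinear (G : SimpleGraph V) (u v : V) : Prop := u ≠ v ∧ ∃ w, G.Adj u w ∧ G.Adj v w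

theorem Collinear.symm {u v : V} (h : G.Collinear u v) : G.Collinear v u :=
  ⟨h.1.symm, h.2.imp fun _ h => h.symm⟩

theorem Collinear.color_eq {u v : V} (h : G.Collinear u v) (c : G.Coloring (Fin 2)) :
    c u = c v := by
  obtain ⟨-, w, h1, h2⟩ := h
  have := c.valid h1
  have := c.valid h2
  omega

theorem Connected.collinear_induction (hconn : G.Connected) (c : G.Coloring (Fin 2)) {u : V}
    {S : V → Prop} (hu : S u) (hS : ∀ x y, S x → G.Collinear x y → S y) {w : V}
    (hw : c w = c u) : S w := by
  -- The induction along a walk also needs an invariant at vertices of the other colour: some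
  -- neighbour satisfies `S`.
  have key : ∀ w, (c w = c u → S w) ∧ (c w ≠ c u → ∃ x, S x ∧ G.Adj x w) := by
    intro w
    have := (reachable_iff_reflTransGen u w).1 (hconn.preconnected u w)
    induction this with
    | refl => exact ⟨fun _ => hu, fun h => absurd rfl h⟩
    | @tail y z _ hyz ih =>
      have hc := c.valid hyz
      refine ⟨fun hz => ?_, fun hz => ?_⟩
      · obtain ⟨x, hx, hxy⟩ := ih.2 (fun h => hc (h.trans hz.symm))
        by_cases hxz : x = z
        · exact hxz ▸ hx
        · exact hS x z hx ⟨hxz, y, hxy, hyz.symm⟩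
      · exact ⟨y, ih.1 (by omega), hyz⟩
  exact (key w).1 hw

theorem exists_adj_notMem [Fintype V] [DecidableRel G.Adj] (hreg : G.IsRegularOfDegree k) (v : V) (s : Finset V)
    (hs : s.card < k) : ∃ w, G.Adj v w ∧ w ∉ s := by
  obtain ⟨w, hw, hws⟩ := Finset.exists_mem_notMem_of_card_lt_card
    (s := s) (t := G.neighborFinset v) (by rwa [card_neighborFinset_eq_degree, hreg.degree_eq])
  exact ⟨w, by simpa using hw, hws⟩

variable [Fintype V] [DecidableEq V] [DecidableRel G.Adj]

/-- The square of the adjacency matrix, shifted so as to have diagonal `2` if the graph is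
`k`-regular. -/
def shiftedSq (G : SimpleGraph V) [DecidableRel G.Adj] (k : ℕ) : Matrix V V ℤ :=
  G.adjMatrix ℤ * G.adjMatrix ℤ - diagonal fun _ => (k : ℤ) - 2

theorem shiftedSq_map (G : SimpleGraph V) [DecidableRel G.Adj] (k : ℕ) :
    (G.shiftedSq k).map (Int.cast : ℤ → ℝ) =
      G.adjMatrix ℝ * G.adjMatrix ℝ - ((k : ℝ) - 2) • (1 : Matrix V V ℝ) := by
  ext u v
  by_cases huv : u = v <;>
    simp [shiftedSq, Matrix.mul_apply, adjMatrix_apply, huv]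

theorem shiftedSq_apply_self (hreg : G.IsRegularOfDegree k) (u : V) : G.shiftedSq k u u = 2 := by
  rw [shiftedSq, Matrix.sub_apply, adjMatrix_mul_self_apply_self, hreg.degree_eq u,
    diagonal_apply_eq]
  ring

theorem shiftedSq_apply_ne {u v : V} (huv : u ≠ v) :
    G.shiftedSq k u v = ({w | G.Adj u w ∧ G.Adj v w} : Finset V).card := by
  simp [shiftedSq, Matrix.sub_apply, diagonal_apply_ne _ huv, Matrix.mul_apply, adjMatrix_apply,
    ← ite_and, G.adj_comm _ v, and_comm]

theorem sum_shiftedSq (hreg : G.IsRegularOfDegree k) (u : V) :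
    ∑ v, G.shiftedSq k u v = (k : ℤ) ^ 2 - k + 2 := by
  have h : (G.adjMatrix ℤ * G.adjMatrix ℤ) *ᵥ Function.const V 1 = fun _ => (k : ℤ) ^ 2 := by
    have h1 : G.adjMatrix ℤ *ᵥ Function.const V 1 = Function.const V (k : ℤ) := by
      ext v
      rw [adjMatrix_mulVec_const_apply_of_regular hreg]; simp
    rw [← mulVec_mulVec, h1]
    ext v
    rw [adjMatrix_mulVec_const_apply_of_regular hreg, sq]
  have h2 := congrFun h u
  simp only [mulVec, dotProduct, Function.const_apply, mul_one] at h2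
  simp only [shiftedSq, Matrix.sub_apply, Finset.sum_sub_distrib, h2]
  simp [diagonal_apply]
  ring

theorem eq_of_common_neighbors (hreg : G.IsRegularOfDegree k)
    (hpos : ((G.shiftedSq k).map (Int.cast : ℤ → ℝ)).PosDef) {u v w x : V} (huv : u ≠ v)
    (huw : G.Adj u w) (hvw : G.Adj v w) (hux : G.Adj u x) (hvx : G.Adj v x) : w = x := by
  by_contra hwx
  have hcard : ∀ a b : V, (a = u ∧ b = v) ∨ (a = v ∧ b = u) → (2 : ℝ) ≤ G.shiftedSq k a b := by
    intro a b hab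
    have h2 : 2 ≤ ({w | G.Adj a w ∧ G.Adj b w} : Finset V).card := by
      rw [← Finset.card_pair hwx]
      apply Finset.card_le_card
      intro y hy
      simp only [Finset.mem_insert, Finset.mem_singleton] at hy
      rw [Finset.mem_filter]
      rcases hab with ⟨rfl, rfl⟩ | ⟨rfl, rfl⟩ <;> rcases hy with rfl | rfl <;> simp [*]
    rw [shiftedSq_apply_ne (by rcases hab with ⟨rfl, rfl⟩ | ⟨rfl, rfl⟩; exacts [huv, huv.symm])]
    exact_mod_cast h2
  have hinj : Function.Injective ![u, v] := by
    intro i j hij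
    fin_cases i <;> fin_cases j <;> simp_all [eq_comm]
  have hp := hpos.submatrix hinj
  have hdet := hp.det_pos
  rw [det_fin_two] at hdet
  simp only [submatrix_apply, map_apply, cons_val_zero, cons_val_one,
    shiftedSq_apply_self hreg] at hdet
  have h1 := hcard u v (.inl ⟨rfl, rfl⟩)
  have h2 := hcard v u (.inr ⟨rfl, rfl⟩)
  push_cast at hdet
  nlinarith

theorem shiftedSq_apply_of_collinear (hreg : G.IsRegularOfDegree k)
    (hpos : ((G.shiftedSq k).map (Int.cast : ℤ → ℝ)).PosDef) {u v : V} (h : G.Collinear u v) :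
    G.shiftedSq k u v = 1 := by
  rw [shiftedSq_apply_ne h.1]
  obtain ⟨huv, w, huw, hvw⟩ := h
  have : ({w | G.Adj u w ∧ G.Adj v w} : Finset V) = {w} := by
    ext x
    simp only [Finset.mem_filter, Finset.mem_univ, true_and, Finset.mem_singleton]
    refine ⟨fun hx => eq_of_common_neighbors hreg hpos huv hx.1 hx.2 huw hvw, ?_⟩
    rintro rfl
    exact ⟨huw, hvw⟩
  rw [this]
  simp

theorem shiftedSq_apply_of_not_collinear {u v : V} (huv : u ≠ v) (h : ¬ G.Collinear u v) :
    G.shiftedSq k u v = 0 := by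
  rw [shiftedSq_apply_ne huv]
  simp only [Nat.cast_eq_zero, Finset.card_eq_zero, Finset.filter_eq_empty_iff]
  exact fun w _ hw => h ⟨huv, w, hw⟩

/-- Entries between colour classes vanish, so the block of one class keeps the row sum k²-k+2 ≥ 8.
This divides a positive determinant that is at most 4. -/
theorem shiftedSq_det_le_false (hk : 3 ≤ k) (hconn : G.Connected) (c : G.Coloring (Fin 2))
    (hreg : G.IsRegularOfDegree k)
    (hpos : ((G.shiftedSq k).map (Int.cast : ℤ → ℝ)).PosDef) {n : ℕ} (hn : 0 < n) {f : Fin n → V}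
    (hf : Function.Injective f) {i : Fin 2} (hc : ∀ j, c (f j) = i) {N : Matrix (Fin n) (Fin n) ℝ}
    (hN : ∀ a b, (G.shiftedSq k (f a) (f b) : ℝ) = N a b) (hdual : DualNormGeOne N)
    (hdet : N.det ≤ 4) : False := by
  let M : Matrix {v // c v = i} {v // c v = i} ℤ :=
    (G.shiftedSq k).submatrix Subtype.val Subtype.val
  let g : Fin n → {v // c v = i} := fun j => ⟨f j, hc j⟩
  have : Nonempty {v // c v = i} := ⟨g ⟨0, hn⟩⟩
  have hMp : (M.map (Int.cast : ℤ → ℝ)).PosDef := hpos.submatrix Subtype.val_injective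
  have hNM : (M.map (Int.cast : ℤ → ℝ)).submatrix g g = N := by
    ext a b; exact hN a b
  have hle : (M.det : ℝ) ≤ 4 := by
    refine det_le_of_submatrix (M := M) (fun v => shiftedSq_apply_self hreg _) hMp ?_ hn (f₀ := g)
      (fun a b hab => hf (congrArg Subtype.val hab)) (hNM ▸ hdual) (hNM ▸ hdet)
    intro X hX hXu
    by_contra! hcon
    obtain ⟨u, hu⟩ := hX
    refine hXu (Finset.eq_univ_iff_forall.2 fun w => ?_)
    have := hconn.collinear_induction c (u := u.1) (S := fun x => ∃ h : c x = i, ⟨x, h⟩ ∈ X)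
      ⟨u.2, hu⟩ (fun x y ⟨hx, hxX⟩ hxy => by
        have hy : c y = i := (hxy.color_eq c).symm.trans hx
        refine ⟨hy, ?_⟩
        by_contra hyX
        have h0 := hcon ⟨y, hy⟩ hyX ⟨x, hx⟩ hxX
        have h1 := shiftedSq_apply_of_collinear hreg hpos hxy.symm
        simp only [M, submatrix_apply] at h0
        omega) (w := w.1) (w.2.trans u.2.symm)
    exact this.2
  have hdvd : (k : ℤ) ^ 2 - k + 2 ∣ M.det := by
    apply rowSum_dvd_det
    intro v
    rw [← sum_shiftedSq hreg v.1]
    rw [← Fintype.sum_subtype_add_sum_subtype (fun w => c w = i)]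
    simp only [M, submatrix_apply]
    rw [left_eq_add]
    refine Finset.sum_eq_zero fun w _ => shiftedSq_apply_of_not_collinear ?_ fun h => ?_
    · rintro h
      exact w.2 (h ▸ v.2)
    · exact w.2 ((h.color_eq c).symm.trans v.2)
  have hMpos : 0 < M.det := by
    have h3 := (Int.castRingHom ℝ).map_det M
    simp only [eq_intCast] at h3
    have := hMp.det_pos
    have h4 : (0 : ℝ) < (M.det : ℝ) := by rw [h3]; exact this
    exact_mod_cast h4
  have hle' : M.det ≤ 4 := by exact_mod_cast hle
  have := Int.le_of_dvd hMpos hdvd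
  have hk' : (3 : ℤ) ≤ k := by exact_mod_cast hk
  nlinarith

theorem no_claw (hk : 3 ≤ k) (hconn : G.Connected) (c : G.Coloring (Fin 2))
    (hreg : G.IsRegularOfDegree k) (hpos : ((G.shiftedSq k).map (Int.cast : ℤ → ℝ)).PosDef)
    {r x y z : V} (hx : G.Collinear r x) (hy : G.Collinear r y) (hz : G.Collinear r z)
    (hxy : x ≠ y) (hxz : x ≠ z) (hyz : y ≠ z) :
    G.Collinear x y ∨ G.Collinear x z ∨ G.Collinear y z := by
  by_contra! h
  obtain ⟨h1, h2, h3⟩ := h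
  have hc := fun u => shiftedSq_apply_of_collinear hreg hpos (u := r) (v := u)
  have hc' := fun u (h : G.Collinear r u) => shiftedSq_apply_of_collinear hreg hpos h.symm
  have hn := fun {u v} => shiftedSq_apply_of_not_collinear (G := G) (k := k) (u := u) (v := v)
  have hn' := fun {u v} (huv : u ≠ v) (h : ¬ G.Collinear u v) =>
    shiftedSq_apply_of_not_collinear (G := G) (k := k) huv.symm (fun h' => h h'.symm)
  refine shiftedSq_det_le_false hk hconn c hreg hpos (n := 4) (by norm_num) (f := ![r, x, y, z])
    (i := c r) ?_ ?_ ?_ dualNormGeOne_claw det_claw.le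
  · have := hx.1
    have := hy.1
    have := hz.1
    intro a b hab
    fin_cases a <;> fin_cases b <;> simp_all [eq_comm]
  · intro a
    fin_cases a
    exacts [rfl, (hx.color_eq c).symm, (hy.color_eq c).symm, (hz.color_eq c).symm]
  · intro a b
    fin_cases a <;> fin_cases b <;>
      simp [shiftedSq_apply_self hreg, hc x hx, hc y hy, hc z hz, hc' x hx, hc' y hy, hc' z hz,
        hn hxy h1, hn hxz h2, hn hyz h3, hn' hxy h1, hn' hxz h2, hn' hyz h3]

theorem no_diamond (hk : 3 ≤ k) (hconn : G.Connected) (c : G.Coloring (Fin 2))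
    (hreg : G.IsRegularOfDegree k) (hpos : ((G.shiftedSq k).map (Int.cast : ℤ → ℝ)).PosDef)
    {r s x y : V} (hrs : G.Collinear r s) (hrx : G.Collinear r x) (hry : G.Collinear r y)
    (hsx : G.Collinear s x) (hsy : G.Collinear s y) (hxy : x ≠ y) : G.Collinear x y := by
  by_contra h
  have hc := fun {u v} => shiftedSq_apply_of_collinear hreg hpos (u := u) (v := v)
  have hn := shiftedSq_apply_of_not_collinear (G := G) (k := k) hxy h
  have hn' := shiftedSq_apply_of_not_collinear (G := G) (k := k) hxy.symm (fun h' => h h'.symm)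
  refine shiftedSq_det_le_false hk hconn c hreg hpos (n := 4) (by norm_num) (f := ![r, s, x, y])
    (i := c r) ?_ ?_ ?_ dualNormGeOne_diamond det_diamond.le
  · have := hrs.1
    have := hrx.1
    have := hry.1
    have := hsx.1
    have := hsy.1
    intro a b hab
    fin_cases a <;> fin_cases b <;> simp_all [eq_comm]
  · intro a
    fin_cases a
    exacts [rfl, (hrs.color_eq c).symm, (hrx.color_eq c).symm, (hry.color_eq c).symm]
  · intro a b
    fin_cases a <;> fin_cases b <;>
      simp [shiftedSq_apply_self hreg, hc hrs, hc hrx, hc hry, hc hsx, hc hsy, hc hrs.symm,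
        hc hrx.symm, hc hry.symm, hc hsx.symm, hc hsy.symm, hn, hn']

open Classical in
theorem card_collinear (hreg : G.IsRegularOfDegree k)
    (hpos : ((G.shiftedSq k).map (Int.cast : ℤ → ℝ)).PosDef) (u : V) :
    (({v | v = u ∨ G.Collinear u v} : Finset V).card : ℤ) = (k : ℤ) ^ 2 - k + 1 := by
  have h := sum_shiftedSq hreg u
  have h1 : ∀ v, G.shiftedSq k u v =
      (if v = u then 1 else 0) + if v = u ∨ G.Collinear u v then 1 else 0 := by
    intro v
    by_cases huv : v = u
    · subst huv
      simp [shiftedSq_apply_self hreg]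
    · by_cases hv : G.Collinear u v
      · simp [huv, hv, shiftedSq_apply_of_collinear hreg hpos hv]
      · simp [huv, hv, shiftedSq_apply_of_not_collinear (Ne.symm huv) hv]
  simp only [h1, Finset.sum_add_distrib, Finset.sum_ite_eq', Finset.mem_univ, if_true,
    Finset.sum_boole] at h
  linarith

/-- Think of `n` as a line through `b` and `x` missing `r`. The closed collinearity neighbourhood of
`r` turns out to lie in that of `b`; both have k²-k+1 elements, so they coincide. -/
theorem collinear_closed_of_triangle (hk : 3 ≤ k) (hconn : G.Connected) (c : G.Coloring (Fin 2))
    (hreg : G.IsRegularOfDegree k) (hpos : ((G.shiftedSq k).map (Int.cast : ℤ → ℝ)).PosDef)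
    {r b x n q : V} (hrb : G.Collinear r b) (hrx : G.Collinear r x) (hbn : G.Adj b n)
    (hxn : G.Adj x n) (hbx : b ≠ x) (hrn : ¬ G.Adj r n) (hbq : G.Collinear b q) :
    q = r ∨ G.Collinear r q := by
  classical
  have hline : ∀ z, G.Adj z n → G.Collinear r z := by
    intro z hz
    by_cases hzb : z = b
    · exact hzb ▸ hrb
    by_cases hzx : z = x
    · exact hzx ▸ hrx
    exact no_diamond hk hconn c hreg hpos (r := b) (s := x) ⟨hbx, n, hbn, hxn⟩ hrb.symm
      ⟨Ne.symm hzb, n, hbn, hz⟩ hrx.symm ⟨Ne.symm hzx, n, hxn, hz⟩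
      (by rintro rfl; exact hrn hz)
  have hmeet : ∀ m, G.Adj r m → ∃ z, G.Adj z n ∧ G.Adj z m := by
    have hex : ∀ z, ∃ m, G.Adj z n → G.Adj r m ∧ G.Adj z m := by
      intro z
      by_cases hz : G.Adj z n
      · obtain ⟨-, m, hm⟩ := hline z hz
        exact ⟨m, fun _ => hm⟩
      · exact ⟨z, fun h => absurd h hz⟩
    choose φ hφ using hex
    -- `φ` sends a point of `n` to the line joining it to `r`. It is injective, since a repeated
    -- line would share two points with `n` and so be `n`, which misses `r`. With k points and k
    -- lines, it is onto.
    have himg : (G.neighborFinset n).image φ = G.neighborFinset r := by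
      apply Finset.eq_of_subset_of_card_le
      · intro m hm
        obtain ⟨z, hz, rfl⟩ := Finset.mem_image.1 hm
        rw [mem_neighborFinset] at hz ⊢
        exact (hφ z hz.symm).1
      · rw [Finset.card_image_of_injOn, card_neighborFinset_eq_degree,
          card_neighborFinset_eq_degree, hreg.degree_eq, hreg.degree_eq]
        intro z hz w hw hzw
        simp only [Finset.mem_coe, mem_neighborFinset] at hz hw
        by_contra hne
        have h1 := hφ z hz.symm
        have h2 := hφ w hw.symm
        have := eq_of_common_neighbors hreg hpos hne hz.symm hw.symm h1.2 (hzw ▸ h2.2)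
        exact hrn (this ▸ h1.1)
    intro m hm
    have : m ∈ (G.neighborFinset n).image φ := by rw [himg]; simpa using hm
    obtain ⟨z, hz, rfl⟩ := Finset.mem_image.1 this
    rw [mem_neighborFinset] at hz
    exact ⟨z, hz.symm, (hφ z hz.symm).2⟩
  have hsub : ({v | v = r ∨ G.Collinear r v} : Finset V) ⊆
      ({v | v = b ∨ G.Collinear b v} : Finset V) := by
    intro y hy
    simp only [Finset.mem_filter, Finset.mem_univ, true_and] at hy ⊢
    by_cases hyb : y = b
    · exact .inl hyb
    right
    obtain rfl | hy := hy
    · exact hrb.symm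
    obtain ⟨hry, m, hrm, hym⟩ := hy
    obtain ⟨z, hzn, hzm⟩ := hmeet m hrm
    by_cases hzb : z = b
    · exact ⟨Ne.symm hyb, m, hzb ▸ hzm, hym⟩
    have hbz : G.Collinear b z := ⟨Ne.symm hzb, n, hbn, hzn⟩
    by_cases hyz : y = z
    · exact hyz ▸ hbz
    exact no_diamond hk hconn c hreg hpos (hline z hzn) hrb ⟨hry, m, hrm, hym⟩ hbz.symm
      ⟨Ne.symm hyz, m, hzm, hym⟩ (Ne.symm hyb)
  have heq := Finset.eq_of_subset_of_card_le hsub (by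
    have h1 := card_collinear hreg hpos r
    have h2 := card_collinear hreg hpos b
    omega)
  have hq : q ∈ ({v | v = r ∨ G.Collinear r v} : Finset V) := by
    rw [heq]
    simp [hbq]
  simpa using hq

theorem collinear_trans (hk : 3 ≤ k) (hconn : G.Connected) (c : G.Coloring (Fin 2))
    (hreg : G.IsRegularOfDegree k) (hpos : ((G.shiftedSq k).map (Int.cast : ℤ → ℝ)).PosDef)
    {r b q : V} (hrb : G.Collinear r b) (hbq : G.Collinear b q) : q = r ∨ G.Collinear r q := by
  by_contra! h
  obtain ⟨hqr, hrq⟩ := h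
  obtain ⟨-, l₁, hrl, hbl⟩ := id hrb
  obtain ⟨-, l₂, hbl', hql⟩ := id hbq
  -- As k ≥ 3 there is a third line through `b`. A further point `x` on it makes `r`, `q`, `x` a
  -- potential claw at `b`, so `x` is collinear with `r` or `q`.
  obtain ⟨n, hbn, hn⟩ := exists_adj_notMem hreg b {l₁, l₂} (Finset.card_le_two.trans_lt hk)
  obtain ⟨x, hnx, hx⟩ := exists_adj_notMem hreg n {b} (by simp; omega)
  simp only [Finset.mem_insert, Finset.mem_singleton, not_or] at hn hx
  have hrn : ¬ G.Adj r n := fun h =>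
    hn.1 (eq_of_common_neighbors hreg hpos hrb.1 h hbn hrl hbl)
  have hqn : ¬ G.Adj q n := fun h =>
    hn.2 (eq_of_common_neighbors hreg hpos hbq.1 hbn h hbl' hql)
  have hbx : G.Collinear b x := ⟨Ne.symm hx, n, hbn, hnx.symm⟩
  rcases no_claw hk hconn c hreg hpos hrb.symm hbq hbx (Ne.symm hqr)
    (by rintro rfl; exact hrn hnx.symm) (by rintro rfl; exact hqn hnx.symm) with h | h | h
  · exact hrq h
  · rcases collinear_closed_of_triangle hk hconn c hreg hpos hrb h hbn hnx.symm hbx.1 hrn hbq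
      with h | h
    exacts [hqr h, hrq h]
  · rcases collinear_closed_of_triangle hk hconn c hreg hpos hbq.symm h hbn hnx.symm hbx.1 hqn
      hrb.symm with h | h
    exacts [hqr h.symm, hrq h.symm]

/-- Any two distinct vertices of the same colour have a common neighbour. -/
theorem collinear_of_color_eq (hk : 3 ≤ k) (hconn : G.Connected) (c : G.Coloring (Fin 2))
    (hreg : G.IsRegularOfDegree k) (hpos : ((G.shiftedSq k).map (Int.cast : ℤ → ℝ)).PosDef)
    {u v : V} (huv : u ≠ v) (hc : c u = c v) : G.Collinear u v := by
  have := hconn.collinear_induction c (u := u) (S := fun w => w = u ∨ G.Collinear u w)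
    (.inl rfl) (fun x y hx hxy => by
      obtain rfl | hx := hx
      · exact .inr hxy
      · exact collinear_trans hk hconn c hreg hpos hx hxy) hc.symm
  exact this.resolve_left huv.symm

end SimpleGraph

end Collinearity

/-! ### The eigenvalue and the projective plane -/

section ProjectivePlane

open Matrix

namespace SimpleGraph

variable {V : Type*} [Fintype V] [DecidableEq V] {G : SimpleGraph V} [DecidableRel G.Adj] {k : ℕ}

theorem sq_sub_mul_sq_sub_eq_zero (hk : 3 ≤ k) (hconn : G.Connected) (c : G.Coloring (Fin 2))
    (hreg : G.IsRegularOfDegree k) (hpos : ((G.shiftedSq k).map (Int.cast : ℤ → ℝ)).PosDef) :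
    (G.adjMatrix ℝ * G.adjMatrix ℝ - (k : ℝ) ^ 2 • (1 : Matrix V V ℝ)) *
      (G.adjMatrix ℝ * G.adjMatrix ℝ - ((k : ℝ) - 1) • (1 : Matrix V V ℝ)) = 0 := by
  let J : Matrix V V ℤ := of fun u v => if c u = c v then 1 else 0
  have happ : ∀ u v, G.shiftedSq k u v = (1 : Matrix V V ℤ) u v + J u v := by
    intro u v
    by_cases huv : u = v
    · subst huv; simp [shiftedSq_apply_self hreg, J]
    by_cases hc : c u = c v
    · rw [shiftedSq_apply_of_collinear hreg hpos
        (collinear_of_color_eq hk hconn c hreg hpos huv hc)]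
      simp [J, hc, huv]
    · rw [shiftedSq_apply_of_not_collinear huv fun h => hc (h.color_eq c)]
      simp [J, hc, huv]
  have hmul : G.shiftedSq k * J = ((k : ℤ) ^ 2 - k + 2) • J := by
    ext u v
    rw [Matrix.mul_apply, Matrix.smul_apply, smul_eq_mul, ← sum_shiftedSq hreg u, Finset.sum_mul]
    refine Finset.sum_congr rfl fun w _ => ?_
    rw [happ]
    by_cases hc : c u = c w
    · simp [J, hc]
    · have : u ≠ w := fun h => hc (h ▸ rfl)
      simp [J, hc, this]
  have hsq : G.adjMatrix ℝ * G.adjMatrix ℝ =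
      (G.shiftedSq k).map (Int.cast : ℤ → ℝ) + ((k : ℝ) - 2) • (1 : Matrix V V ℝ) := by
    rw [shiftedSq_map]; simp
  have hJ : (G.shiftedSq k).map (Int.cast : ℤ → ℝ) = 1 + J.map (Int.cast : ℤ → ℝ) := by
    ext u v
    rw [map_apply, happ]
    simp [Matrix.one_apply]
  have hmul' : (G.shiftedSq k).map (Int.cast : ℤ → ℝ) * J.map (Int.cast : ℤ → ℝ) =
      ((k : ℝ) ^ 2 - k + 2) • J.map (Int.cast : ℤ → ℝ) := by
    ext u v
    have := congrArg (Int.cast : ℤ → ℝ) (congrFun (congrFun hmul u) v)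
    simpa [Matrix.mul_apply] using this
  have h1 : G.adjMatrix ℝ * G.adjMatrix ℝ - ((k : ℝ) - 1) • (1 : Matrix V V ℝ) =
      J.map (Int.cast : ℤ → ℝ) := by
    rw [hsq, hJ]; module
  -- The row sum gives MJ = (k²-k+2)J, hence A²J = k²J.
  rw [h1, hsq, Matrix.sub_mul, Matrix.add_mul, hmul', Matrix.smul_mul, Matrix.smul_mul, one_mul]
  module

end SimpleGraph

namespace HLPaper

open SimpleGraph

variable {V : Type u} [Fintype V] [DecidableEq V] {G : SimpleGraph V} [DecidableRel G.Adj] {k : ℕ}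

theorem HLIndex_eq_sqrt [Nonempty V] (hk : 3 ≤ k) (hconn : G.Connected) (c : G.Coloring (Fin 2))
    (hreg : G.IsRegularOfDegree k) (hpos : ((G.shiftedSq k).map (Int.cast : ℤ → ℝ)).PosDef) :
    HLIndex G = √((k : ℝ) - 1) := by
  have hA := G.isHermitian_adjMatrix ℝ
  have hk' : (3 : ℝ) ≤ k := by exact_mod_cast hk
  obtain ⟨v, hv⟩ := exists_eigenvalue_eq_HLIndex c
  rcases hA.eigenvalues_sq_eq_or (sq_sub_mul_sq_sub_eq_zero hk hconn c hreg hpos) v with h | h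
  -- If the least squared eigenvalue were k², the trace nk of A² would be at least nk².
  · exfalso
    rw [hv] at h
    have htr := hA.trace_sq
    have h1 : (G.adjMatrix ℝ * G.adjMatrix ℝ).trace = Fintype.card V * k := by
      simp only [trace, diag_apply, adjMatrix_mul_self_apply_self, hreg.degree_eq]
      simp
    have h2 : ∑ _i : V, (k : ℝ) ^ 2 ≤ ∑ i, hA.eigenvalues i ^ 2 :=
      Finset.sum_le_sum fun i _ => h ▸ HLIndex_sq_le c i
    rw [← htr, h1] at h2
    simp only [Finset.sum_const, Finset.card_univ, nsmul_eq_mul] at h2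
    have h3 : (0 : ℝ) < Fintype.card V := by exact_mod_cast Fintype.card_pos
    have := le_of_mul_le_mul_left h2 h3
    nlinarith
  · rw [hv] at h
    rw [← h, Real.sqrt_sq (HLIndex_eq c).2]

theorem isIncidenceGraphOfProjectivePlane [Nonempty V] (hk : 3 ≤ k) (hconn : G.Connected)
    (c : G.Coloring (Fin 2)) (hreg : G.IsRegularOfDegree k)
    (hpos : ((G.shiftedSq k).map (Int.cast : ℤ → ℝ)).PosDef) :
    IsIncidenceGraphOfProjectivePlane G (k - 1) := by
  classical
  have hcol : ∀ {u v : V}, u ≠ v → c u = c v → ∃ w, G.Adj u w ∧ G.Adj v w := fun huv hc =>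
    (collinear_of_color_eq hk hconn c hreg hpos huv hc).2
  have huniq := fun {u v w x : V} => eq_of_common_neighbors hreg hpos (u := u) (v := v) (w := w)
    (x := x)
  have hc01 : ∀ {u v : V}, G.Adj u v → c u = 0 → c v ≠ 0 := fun h h0 h1 =>
    c.valid h (h0.trans h1.symm)
  have hc10 : ∀ {u v : V}, G.Adj u v → c u ≠ 0 → c v = 0 := fun h h0 => by
    have := c.valid h
    omega
  let P := {v : V // c v = 0}
  let L := {v : V // ¬ c v = 0}
  let mem : Membership P L := ⟨fun l p => G.Adj p.1 l.1⟩
  have hmem : ∀ (p : P) (l : L), p ∈ l ↔ G.Adj p.1 l.1 := fun _ _ => Iff.rfl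
  have hline : ∀ p₁ p₂ : P, p₁ ≠ p₂ → ∃ l : L, p₁ ∈ l ∧ p₂ ∈ l := by
    intro p₁ p₂ hne
    obtain ⟨w, h1, h2⟩ := hcol (fun h => hne (Subtype.ext h)) (p₁.2.trans p₂.2.symm)
    exact ⟨⟨w, hc01 h1 p₁.2⟩, h1, h2⟩
  have hpoint : ∀ l₁ l₂ : L, l₁ ≠ l₂ → ∃ p : P, p ∈ l₁ ∧ p ∈ l₂ := by
    intro l₁ l₂ hne
    obtain ⟨w, h1, h2⟩ := hcol (u := l₁.1) (v := l₂.1) (fun h => hne (Subtype.ext h)) (by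
      have := l₁.2
      have := l₂.2
      omega)
    exact ⟨⟨w, hc10 h1 l₁.2⟩, h1.symm, h2.symm⟩
  have hunique : ∀ (p₁ p₂ : P) (l₁ l₂ : L), p₁ ∈ l₁ → p₂ ∈ l₁ → p₁ ∈ l₂ → p₂ ∈ l₂ →
      p₁ = p₂ ∨ l₁ = l₂ := by
    intro p₁ p₂ l₁ l₂ h11 h21 h12 h22
    by_contra! h
    exact h.2 (Subtype.ext (huniq (fun h' => h.1 (Subtype.ext h')) h11 h21 h12 h22))
  have hexl : ∀ (p : P) (l₁ l₂ : L), ∃ l : L, p ∈ l ∧ l ≠ l₁ ∧ l ≠ l₂ := by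
    intro p l₁ l₂
    obtain ⟨w, hw, hws⟩ := exists_adj_notMem hreg p.1 {l₁.1, l₂.1}
      (Finset.card_le_two.trans_lt hk)
    simp only [Finset.mem_insert, Finset.mem_singleton, not_or] at hws
    exact ⟨⟨w, hc01 hw p.2⟩, hw, fun h => hws.1 (congrArg Subtype.val h),
      fun h => hws.2 (congrArg Subtype.val h)⟩
  have hexp : ∀ (l : L) (p₁ p₂ : P), ∃ p : P, p ∈ l ∧ p ≠ p₁ ∧ p ≠ p₂ := by
    intro l p₁ p₂
    obtain ⟨w, hw, hws⟩ := exists_adj_notMem hreg l.1 {p₁.1, p₂.1}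
      (Finset.card_le_two.trans_lt hk)
    simp only [Finset.mem_insert, Finset.mem_singleton, not_or] at hws
    exact ⟨⟨w, hc10 hw l.2⟩, hw.symm, fun h => hws.1 (congrArg Subtype.val h),
      fun h => hws.2 (congrArg Subtype.val h)⟩
  have hP : Nonempty P := by
    obtain ⟨v⟩ := ‹Nonempty V›
    by_cases hv : c v = 0
    · exact ⟨⟨v, hv⟩⟩
    · obtain ⟨w, hw, -⟩ := exists_adj_notMem hreg v ∅ (by simp; omega)
      exact ⟨⟨w, hc10 hw hv⟩⟩
  have hconfig : ∃ (p₁ p₂ p₃ : P) (l₁ l₂ l₃ : L), p₁ ∉ l₂ ∧ p₁ ∉ l₃ ∧ p₂ ∉ l₁ ∧ p₂ ∈ l₂ ∧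
      p₂ ∈ l₃ ∧ p₃ ∉ l₁ ∧ p₃ ∈ l₂ ∧ p₃ ∉ l₃ := by
    obtain ⟨p₂⟩ := hP
    obtain ⟨w, hw, -⟩ := exists_adj_notMem hreg p₂.1 ∅ (by simp; omega)
    let l₂ : L := ⟨w, hc01 hw p₂.2⟩
    have h22 : p₂ ∈ l₂ := hw
    obtain ⟨p₃, h32, hp32, -⟩ := hexp l₂ p₂ p₂
    obtain ⟨l₃, h23, hl32, -⟩ := hexl p₂ l₂ l₂
    -- A third line through `p₂` carries `p₁`, keeping it off `l₂` and `l₃`; `l₁` then passes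
    -- through `p₁` and avoids the lines joining it to `p₂` and `p₃`.
    obtain ⟨l, h2l, hl2, hl3⟩ := hexl p₂ l₂ l₃
    obtain ⟨p₁, h1l, hp12, -⟩ := hexp l p₂ p₂
    have h12 : p₁ ∉ l₂ := fun h => (hunique _ _ _ _ h1l h2l h h22).elim hp12 hl2
    have h13 : p₁ ∉ l₃ := fun h => (hunique _ _ _ _ h1l h2l h h23).elim hp12 hl3
    obtain ⟨m, h1m, h3m⟩ := hline p₁ p₃ (fun h => h12 (h ▸ h32))
    obtain ⟨l₁, h11, hl1, hl1m⟩ := hexl p₁ l m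
    refine ⟨p₁, p₂, p₃, l₁, l₂, l₃, h12, h13, fun h => ?_, h22, h23, fun h => ?_, h32, fun h => ?_⟩
    · exact (hunique _ _ _ _ h11 h h1l h2l).elim hp12 hl1
    · exact (hunique _ _ _ _ h11 h h1m h3m).elim (fun h => h12 (h ▸ h32)) hl1m
    · exact (hunique _ _ _ _ h h23 h32 h22).elim hp32 hl32
  obtain ⟨p₁, p₂, p₃, l₁, l₂, l₃, hcfg⟩ := id hconfig
  let plane : Configuration.ProjectivePlane P L :=
    { exists_point := fun l => by
        by_contra! h
        obtain ⟨h12, -, -, h22, h23, -, h32, h33⟩ := hcfg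
        rcases hunique p₂ p₃ l l₂ (h _) (h _) h22 h32 with h' | h'
        · exact h33 (h' ▸ h23)
        · exact h12 (h' ▸ h p₁)
      exists_line := fun p => by
        by_contra! h
        obtain ⟨-, -, h21, h22, h23, -, h32, h33⟩ := hcfg
        rcases hunique p p₂ l₂ l₃ (h _) h22 (h _) h23 with h' | h'
        · exact h21 (h' ▸ h l₁)
        · exact h33 (h' ▸ h32)
      eq_or_eq := fun {p₁ p₂ l₁ l₂} => hunique p₁ p₂ l₁ l₂
      mkPoint := fun {l₁ l₂} h => (hpoint l₁ l₂ h).choose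
      mkPoint_ax := fun {l₁ l₂} h => (hpoint l₁ l₂ h).choose_spec
      mkLine := fun {p₁ p₂} h => (hline p₁ p₂ h).choose
      mkLine_ax := fun {p₁ p₂} h => (hline p₁ p₂ h).choose_spec
      exists_config := hconfig }
  refine ⟨P, L, inferInstance, inferInstance, mem, plane, ?_, ⟨?_⟩⟩
  · have h1 := Configuration.ProjectivePlane.lineCount_eq (P := P) (L := L) p₁
    have h2 : Configuration.lineCount L p₁ = k := by
      rw [← hreg.degree_eq p₁.1, ← card_neighborSet_eq_degree, ← Nat.card_eq_fintype_card]
      exact Nat.card_congr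
        { toFun := fun l => ⟨l.1.1, l.2⟩
          invFun := fun w => ⟨⟨w.1, hc01 w.2 p₁.2⟩, w.2⟩
          left_inv := fun _ => rfl
          right_inv := fun _ => rfl }
    omega
  · refine RelIso.symm ⟨Equiv.sumCompl fun v => c v = 0, ?_⟩
    rintro (p | l) (q | m)
    · exact ⟨fun h => absurd q.2 (hc01 h p.2), False.elim⟩
    · exact Iff.rfl
    · exact G.adj_comm _ _
    · exact ⟨fun h => absurd (hc10 h l.2) m.2, False.elim⟩

end HLPaper

end ProjectivePlane

theorem theorem2p1 {V : Type u} [Fintype V] [DecidableEq V] [Nonempty V]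
    (G : SimpleGraph V) [DecidableRel G.Adj] (k : ℕ) (hk : 3 ≤ k)
    (hconn : G.Connected) (hbip : G.IsBipartite) (hreg : G.IsRegularOfDegree k)
    (hR : Real.sqrt ((k : ℝ) - 2) < HLPaper.HLIndex G) :
    HLPaper.HLIndex G = Real.sqrt ((k : ℝ) - 1) ∧
      HLPaper.IsIncidenceGraphOfProjectivePlane G (k - 1) := by
  obtain ⟨c⟩ := hbip
  have hk' : (3 : ℝ) ≤ k := by exact_mod_cast hk
  have hpos : ((G.shiftedSq k).map (Int.cast : ℤ → ℝ)).PosDef := by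
    rw [SimpleGraph.shiftedSq_map]
    refine (G.isHermitian_adjMatrix ℝ).posDef_sq_sub fun v => ?_
    refine lt_of_lt_of_le ?_ (HLPaper.HLIndex_sq_le c v)
    calc (k : ℝ) - 2 = √((k : ℝ) - 2) ^ 2 := (Real.sq_sqrt (by linarith)).symm
      _ < _ := pow_lt_pow_left₀ hR (Real.sqrt_nonneg _) two_ne_zero
  exact ⟨HLPaper.HLIndex_eq_sqrt hk hconn c hreg hpos,
    HLPaper.isIncidenceGraphOfProjectivePlane hk hconn c hreg hpos⟩
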